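/- A *rational (respectively integral) polytope* in $\mathbb{R}^d$ is a convex hull of finitely many points all of whose vertices have rational (respectively integral) coordinates. A *rational polygon* is a rational polytope in $\mathbb{R}^2$ with non-empty interior. For such $P$ put $nP=\{nx : x\in P\}$, let $i_P(n)=\#(nP\cap\mathbb{Z}^2)$ for integers $n\ge 0$, and let $\partial_P(n)=\#(\mathrm{boundary}(nP)\cap\mathbb{Z}^2)$ for integers $n\ge 1$. **Theorem 3.1.** Let $P\subset\mathbb{R}^2$ be a rational polygon, let $A$ be its area, and let $\mathcal D=\min\{n\in\mathbb{Z}_{>0} : nP \text{ is an integral polytope}\}$ be its denominator. Then the following are equivalent: 1. $i_P(n)$ is a polynomial in $n$, i.e. there is a polynomial $p$ with real coefficients with $i_P(n)=p(n)$ for all integers $n\ge 0$; 2. $i_P(n)=An^2+\frac12\,\partial_P(1)\,n+1$ for all integers $n\ge 0$; 3. for all integers $n\ge 1$, both (a) $nP$ obeys Pick's theorem, i.e. $i_P(n)=An^2+\frac12\,\partial_P(n)+1$, and (b) $\partial_P(n)=n\,\partial_P(1)$; 4. (a) and (b) of condition 3 hold for $n=1,2,\ldots,\mathcal D$. -/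

import Mathlib

open scoped Pointwise

/-- A polytope in `ℝ^d`: the convex hull of a finite set of points. -/
def IsPolytope {d : ℕ} (P : Set (Fin d → ℝ)) : Prop :=
  ∃ V : Set (Fin d → ℝ), V.Finite ∧ P = convexHull ℝ V

/-- A polytope all of whose vertices (extreme points) have rational coordinates. -/
def IsRationalPolytope {d : ℕ} (P : Set (Fin d → ℝ)) : Prop :=
  IsPolytope P ∧ ∀ v ∈ P.extremePoints ℝ, ∀ i, ∃ q : ℚ, v i = (q : ℝ)

/-- A polytope all of whose vertices (extreme points) have integral coordinates. -/
def IsIntegralPolytope {d : ℕ} (P : Set (Fin d → ℝ)) : Prop :=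
  IsPolytope P ∧ ∀ v ∈ P.extremePoints ℝ, ∀ i, ∃ z : ℤ, v i = (z : ℝ)

/-- A rational polygon: a two-dimensional rational polytope in the plane. -/
def IsRationalPolygon (P : Set (Fin 2 → ℝ)) : Prop :=
  IsRationalPolytope P ∧ (interior P).Nonempty

/-- The denominator of `P`: the least positive integer `n` such that `nP` is an integral
polytope. -/
noncomputable def denominator {d : ℕ} (P : Set (Fin d → ℝ)) : ℕ :=
  sInf {n : ℕ | 0 < n ∧ IsIntegralPolytope ((n : ℝ) • P)}

/-- The integer lattice `ℤ^d` inside `ℝ^d`. -/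
def integerLattice (d : ℕ) : Set (Fin d → ℝ) :=
  {x | ∀ i, ∃ z : ℤ, x i = (z : ℝ)}

/-- The number `i_P(n)` of lattice points in the dilate `nP`. -/
noncomputable def ehrhartCount {d : ℕ} (P : Set (Fin d → ℝ)) (n : ℕ) : ℕ :=
  (((n : ℝ) • P) ∩ integerLattice d).ncard

/-- The number `∂_P(n)` of lattice points on the boundary of the dilate `nP`. -/
noncomputable def boundaryCount {d : ℕ} (P : Set (Fin d → ℝ)) (n : ℕ) : ℕ :=
  (frontier ((n : ℝ) • P) ∩ integerLattice d).ncard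

/-! Let `i(n)` and `o(n)` count the lattice points of `nP` and of its interior. By Ehrhart–Macdonald
reciprocity, one function `Q` on `ℤ`, quadratic on each class mod `D`, satisfies `i(n) = Q(n)` for
`n ≥ 0` and `o(n) = Q(-n)` for `n ≥ 1`; hence `∂(n) = Q(n) - Q(-n)`. Area asymptotics make `A` the
coefficient of `n²` on every class, so two values of `Q` on a class determine it there.

If `i` is a polynomial, comparison with `Q` on multiples of `D` gives `An² + βn + 1`, and `∂(n) =
Q(n) - Q(-n) = 2βn` yields the other conditions. Conversely, suppose (a) and (b) hold up to `D`, and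
let `1 ≤ r ≤ D`. They give `Q(r)`, and also `Q(r - D) = o(D - r) = i(D - r) - ∂(D - r)` if `r < D`;
if `r = D` the second value is `Q(0) = 1`. Both values fit `An² + ½∂(1)n + 1`, so all of `Q` does.

Reciprocity is proved for simplices in cone coordinates (`reciprocal_ncard_simplicialCone`):
splitting weights into integer and fractional parts reduces it to a symmetry of the polynomial
counting vectors in `ℕ^k` of given sum. It passes to polygons by cutting along diagonals
(`reciprocal_ehrhartCount_convexHull`). -/

/-- A function on `ℤ` which is a quadratic polynomial on each residue class modulo `D`. -/
def IsQuasiQuadratic (D : ℕ) (Q : ℤ → ℝ) : Prop :=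
  ∀ r : ℤ, ∃ a b c : ℝ, ∀ m : ℤ, Q (r + D * m) = a * (m : ℝ) ^ 2 + b * m + c

/-- `f` and `g` are the values at nonnegative and at negative arguments of a single
quasi-quadratic function: the shape of Ehrhart–Macdonald reciprocity in dimension at most two. -/
def Reciprocal (D : ℕ) (f g : ℕ → ℝ) : Prop :=
  ∃ Q : ℤ → ℝ, IsQuasiQuadratic D Q ∧ (∀ n : ℕ, f n = Q n) ∧ ∀ n : ℕ, 1 ≤ n → g n = Q (-n)

/-! ### Algebra of quasi-quadratic functions and reciprocal pairs -/

theorem IsQuasiQuadratic.add {D : ℕ} {Q R : ℤ → ℝ} (hQ : IsQuasiQuadratic D Q)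
    (hR : IsQuasiQuadratic D R) : IsQuasiQuadratic D (fun x => Q x + R x) := by
  intro r
  obtain ⟨a, b, c, h⟩ := hQ r
  obtain ⟨a', b', c', h'⟩ := hR r
  exact ⟨a + a', b + b', c + c', fun m => by simp only [h, h']; ring⟩

theorem IsQuasiQuadratic.sub {D : ℕ} {Q R : ℤ → ℝ} (hQ : IsQuasiQuadratic D Q)
    (hR : IsQuasiQuadratic D R) : IsQuasiQuadratic D (fun x => Q x - R x) := by
  intro r
  obtain ⟨a, b, c, h⟩ := hQ r
  obtain ⟨a', b', c', h'⟩ := hR r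
  exact ⟨a - a', b - b', c - c', fun m => by simp only [h, h']; ring⟩

theorem IsQuasiQuadratic.sum {D : ℕ} {α : Type*} (s : Finset α) {Q : α → ℤ → ℝ}
    (hQ : ∀ i ∈ s, IsQuasiQuadratic D (Q i)) :
    IsQuasiQuadratic D (fun x => ∑ i ∈ s, Q i x) := by
  classical
  induction s using Finset.induction_on with
  | empty => exact fun r => ⟨0, 0, 0, by simp⟩
  | insert i s hi ih =>
    simp only [Finset.sum_insert hi]
    exact (hQ i (Finset.mem_insert_self _ _)).add
      (ih fun j hj => hQ j (Finset.mem_insert_of_mem hj))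

theorem Reciprocal.add {D : ℕ} {f g f' g' : ℕ → ℝ} (h : Reciprocal D f g)
    (h' : Reciprocal D f' g') :
    Reciprocal D (fun n => f n + f' n) (fun n => g n + g' n) := by
  obtain ⟨Q, hQ, h1, h2⟩ := h
  obtain ⟨R, hR, h3, h4⟩ := h'
  exact ⟨_, hQ.add hR, fun n => by simp only [h1, h3], fun n hn => by simp only [h2 n hn, h4 n hn]⟩

theorem Reciprocal.sub {D : ℕ} {f g f' g' : ℕ → ℝ} (h : Reciprocal D f g)
    (h' : Reciprocal D f' g') :
    Reciprocal D (fun n => f n - f' n) (fun n => g n - g' n) := by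
  obtain ⟨Q, hQ, h1, h2⟩ := h
  obtain ⟨R, hR, h3, h4⟩ := h'
  exact ⟨_, hQ.sub hR, fun n => by simp only [h1, h3], fun n hn => by simp only [h2 n hn, h4 n hn]⟩

theorem Reciprocal.congr {D : ℕ} {f g f' g' : ℕ → ℝ} (h : Reciprocal D f g)
    (hf : ∀ n, f' n = f n) (hg : ∀ n, 1 ≤ n → g' n = g n) : Reciprocal D f' g' := by
  obtain ⟨Q, hQ, h1, h2⟩ := h
  exact ⟨Q, hQ, fun n => by rw [hf, h1], fun n hn => by rw [hg n hn, h2 n hn]⟩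

/-! ### Reciprocity for simplicial cones -/

/-- `q (x / D)` on the multiples of `D`, and `0` elsewhere. -/
noncomputable def onMultiples (q : ℤ → ℝ) (D : ℕ) (x : ℤ) : ℝ :=
  open Classical in if (D : ℤ) ∣ x then q (x / D) else 0

theorem onMultiples_mul (q : ℤ → ℝ) {D : ℕ} (hD : 0 < D) (t : ℤ) :
    onMultiples q D (D * t) = q t := by
  have : (D : ℤ) ≠ 0 := by positivity
  simp [onMultiples, Int.mul_ediv_cancel_left t this]

theorem isQuasiQuadratic_onMultiples {q : ℤ → ℝ} {D : ℕ} (hD : 0 < D)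
    (hq : ∃ a b c : ℝ, ∀ t : ℤ, q t = a * (t : ℝ) ^ 2 + b * t + c) (h : ℤ) :
    IsQuasiQuadratic D (fun x => onMultiples q D (x - h)) := by
  obtain ⟨a, b, c, hq⟩ := hq
  intro r
  by_cases hr : (D : ℤ) ∣ r - h
  · obtain ⟨t, ht⟩ := hr
    refine ⟨a, 2 * a * t + b, a * t ^ 2 + b * t + c, fun m => ?_⟩
    have : r + D * m - h = D * (t + m) := by linear_combination ht
    simp only [this, onMultiples_mul q hD, hq]
    push_cast
    ring
  · refine ⟨0, 0, 0, fun m => ?_⟩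
    have : ¬ (D : ℤ) ∣ r + D * m - h := fun hd => hr <| by
      have := dvd_sub hd (Dvd.intro m rfl)
      rwa [show r + D * m - h - D * m = r - h by ring] at this
    simp [onMultiples, this]

/-- A point `γ + m` has height `c + D ∑ mᵢ`, so only heights congruent to `c` mod `D` occur. The
zeros of `q` at `-k < t < 0` keep the formula valid below `c`, down to `c - kD`. -/
theorem ncard_translates_eq_onMultiples {k D : ℕ} (hD : 0 < D) {q : ℤ → ℝ}
    (hq : ∀ t : ℕ, ({m : Fin k → ℕ | ∑ i, m i = t}.ncard : ℝ) = q t)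
    (hneg : ∀ t : ℤ, -k < t → t < 0 → q t = 0)
    (γ : Fin k → ℝ) (c : ℤ) (hc : D * ∑ i, γ i = c) (n : ℕ) (hn : -(k * D : ℤ) < n - c) :
    ({θ : Fin k → ℝ | (∃ m : Fin k → ℕ, θ = fun i => γ i + m i) ∧ D * ∑ i, θ i = n}.ncard : ℝ)
      = onMultiples q D (n - c) := by
  have key : ∀ m : Fin k → ℕ, (D * ∑ i, (γ i + (m i : ℝ)) = n) ↔
      (n : ℤ) - c = D * ((∑ i, m i : ℕ) : ℤ) := by
    intro m
    rw [Finset.sum_add_distrib, mul_add, hc, ← @Int.cast_inj ℝ]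
    push_cast
    constructor <;> intro h <;> linarith
  by_cases hd : (D : ℤ) ∣ n - c
  · obtain ⟨t, ht⟩ := hd
    rw [ht, onMultiples_mul q hD]
    have hD' : (0 : ℤ) < D := by exact_mod_cast hD
    rcases lt_or_ge t 0 with h0 | h0
    · rw [hneg t (by nlinarith) h0]
      rw [Set.eq_empty_of_forall_notMem (s := {θ : Fin k → ℝ | _}), Set.ncard_empty,
        Nat.cast_zero]
      rintro θ ⟨⟨m, rfl⟩, h⟩
      rw [key, ht] at h
      have := mul_left_cancel₀ hD'.ne' h
      have : (0 : ℤ) ≤ ((∑ i, m i : ℕ) : ℤ) := by positivity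
      omega
    · lift t to ℕ using h0
      rw [← hq, ← Set.ncard_image_of_injective (f := fun (m : Fin k → ℕ) i => γ i + (m i : ℝ))]
      · congr 2
        ext θ
        constructor
        · rintro ⟨⟨m, rfl⟩, h⟩
          rw [key, ht] at h
          exact ⟨m, by exact_mod_cast (mul_left_cancel₀ hD'.ne' h).symm, rfl⟩
        · rintro ⟨m, hm, rfl⟩
          refine ⟨⟨m, rfl⟩, (key m).2 ?_⟩
          rw [ht, show ∑ i, m i = t from hm]
      · intro m m' h
        ext i
        simpa using congrFun h i
  · rw [Set.eq_empty_of_forall_notMem (s := {θ : Fin k → ℝ | _}), Set.ncard_empty,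
        Nat.cast_zero]
    · simp [onMultiples, hd]
    · rintro θ ⟨⟨m, rfl⟩, h⟩
      rw [key] at h
      exact hd ⟨_, h⟩

theorem ncard_eq_sum_ncard_fibers {α β : Type*} {s : Set α} (hs : s.Finite) {t : Finset β}
    (f : α → β) (hf : ∀ a ∈ s, f a ∈ t) :
    s.ncard = ∑ b ∈ t, {a | a ∈ s ∧ f a = b}.ncard := by
  classical
  rw [Set.ncard_eq_toFinset_card s hs,
    Finset.card_eq_sum_card_fiberwise (f := f) (t := t) (by intro a ha; exact hf a (by simpa using ha))]
  refine Finset.sum_congr rfl fun b _ => ?_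
  rw [← Set.ncard_coe_finset]
  congr 1
  ext a
  simp

/-- Reciprocity for the lattice points of a simplicial cone, in the coordinates given by the
generators of the cone. -/
theorem reciprocal_ncard_simplicialCone {k D : ℕ} (hk : 0 < k) (hD : 0 < D)
    (Λ : AddSubgroup (Fin k → ℝ)) (hZ : ∀ m : Fin k → ℤ, (fun i => (m i : ℝ)) ∈ Λ)
    (hH : ∀ θ ∈ Λ, ∃ z : ℤ, D * ∑ i, θ i = z)
    (hfin : ∀ n : ℕ, {θ | θ ∈ Λ ∧ (∀ i, 0 ≤ θ i) ∧ D * ∑ i, θ i = n}.Finite)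
    {q : ℤ → ℝ} {ε : ℝ} (hε : ε * ε = 1)
    (hq : ∀ t : ℕ, ({m : Fin k → ℕ | ∑ i, m i = t}.ncard : ℝ) = q t)
    (hneg : ∀ t : ℤ, -k < t → t < 0 → q t = 0)
    (hsymm : ∀ t : ℤ, q (-k - t) = ε * q t)
    (hquad : ∃ a b c : ℝ, ∀ t : ℤ, q t = a * (t : ℝ) ^ 2 + b * t + c) :
    Reciprocal D
      (fun n => {θ | θ ∈ Λ ∧ (∀ i, 0 ≤ θ i) ∧ D * ∑ i, θ i = n}.ncard)
      (fun n => ε * {θ | θ ∈ Λ ∧ (∀ i, 0 < θ i) ∧ D * ∑ i, θ i = n}.ncard) := by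
  have hDR : (0 : ℝ) < D := by exact_mod_cast hD
  have : Nonempty (Fin k) := ⟨⟨0, hk⟩⟩
  choose! h hh using hH
  have hsum_nonneg : ∀ θ : Fin k → ℝ, (∀ i, 0 ≤ θ i) → 0 ≤ ∑ i, θ i :=
    fun θ hθ => Finset.sum_nonneg fun i _ => hθ i
  have hlt : ∀ θ ∈ Λ, (∀ i, θ i < 1) → h θ < k * D := by
    intro θ hθ h1
    have : ∑ i, θ i < k := by
      calc ∑ i, θ i < ∑ i : Fin k, (1 : ℝ) :=
            Finset.sum_lt_sum_of_nonempty Finset.univ_nonempty fun i _ => h1 i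
        _ = k := by simp
    have h2 : ((h θ : ℤ) : ℝ) < ((k * D : ℤ) : ℝ) := by
      rw [← hh θ hθ]
      push_cast
      nlinarith
    exact_mod_cast h2
  have hnonneg : ∀ θ ∈ Λ, (∀ i, 0 ≤ θ i) → 0 ≤ h θ := by
    intro θ hθ h1
    have : (0 : ℝ) ≤ (h θ : ℤ) := by
      rw [← hh θ hθ]
      exact mul_nonneg hDR.le (hsum_nonneg θ h1)
    exact_mod_cast this
  -- The lattice points of the half-open fundamental parallelepiped, whose heights lie in `[0, kD)`.
  have hBfin : {β | β ∈ Λ ∧ (∀ i, 0 ≤ β i) ∧ ∀ i, β i < 1}.Finite := by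
    refine ((Set.finite_lt_nat (k * D)).biUnion fun n _ => hfin n).subset ?_
    rintro β ⟨h1, h2, h3⟩
    have h4 := hnonneg β h1 h2
    have h5 := hlt β h1 h3
    refine Set.mem_biUnion (x := (h β).toNat) (show (h β).toNat < k * D by zify; omega)
      ⟨h1, h2, ?_⟩
    rw [hh β h1]
    exact_mod_cast (Int.toNat_of_nonneg h4).symm
  have hfract : ∀ θ ∈ Λ, (fun i => Int.fract (θ i)) ∈ hBfin.toFinset := by
    intro θ hθ
    rw [Set.Finite.mem_toFinset]
    refine ⟨?_, fun i => Int.fract_nonneg _, fun i => Int.fract_lt_one _⟩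
    exact Λ.sub_mem hθ (hZ fun i => ⌊θ i⌋)
  refine ⟨fun x => ∑ β ∈ hBfin.toFinset, onMultiples q D (x - h β),
    IsQuasiQuadratic.sum _ fun β _ => isQuasiQuadratic_onMultiples hD hquad _,
    fun n => ?_, fun n hn => ?_⟩
  · beta_reduce
    rw [ncard_eq_sum_ncard_fibers (hfin n) (fun θ i => Int.fract (θ i))
      (fun θ hθ => hfract θ hθ.1)]
    push_cast
    refine Finset.sum_congr rfl fun β hβ => ?_
    obtain ⟨hβ, hβ0, hβ1⟩ := hBfin.mem_toFinset.1 hβ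
    rw [← ncard_translates_eq_onMultiples hD hq hneg β (h β) (hh β hβ) n
      (by have := hlt β hβ hβ1; omega)]
    congr 2
    ext θ
    constructor
    · rintro ⟨⟨h1, h2, h3⟩, rfl⟩
      refine ⟨⟨fun i => ⌊θ i⌋.toNat, ?_⟩, h3⟩
      ext i
      have : ((⌊θ i⌋.toNat : ℤ) : ℝ) = (⌊θ i⌋ : ℝ) := by
        rw [Int.toNat_of_nonneg (Int.floor_nonneg.2 (h2 i))]
      rw [Int.cast_natCast] at this
      rw [this, Int.fract_add_floor]
    · rintro ⟨⟨m, rfl⟩, h3⟩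
      refine ⟨⟨Λ.add_mem hβ (by simpa using hZ fun i => (m i : ℤ)),
        fun i => add_nonneg (hβ0 i) (Nat.cast_nonneg _), h3⟩, ?_⟩
      ext i
      simp [Int.fract_eq_self.2 ⟨hβ0 i, hβ1 i⟩]
  · beta_reduce
    have hfin' : {θ | θ ∈ Λ ∧ (∀ i, 0 < θ i) ∧ D * ∑ i, θ i = n}.Finite :=
      (hfin n).subset fun θ hθ => ⟨hθ.1, fun i => (hθ.2.1 i).le, hθ.2.2⟩
    -- For strictly positive weights, round up: if `β = fract (-θ)`, then `θ = (1 - β) + m` with `m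
    -- = ⌈θ⌉ - 1 ≥ 0`. The same set of `β` thus indexes both counts.
    rw [ncard_eq_sum_ncard_fibers (t := hBfin.toFinset) hfin'
      (fun θ i => Int.fract (-θ i)) (fun θ hθ => hfract (-θ) (Λ.neg_mem hθ.1))]
    push_cast
    rw [Finset.mul_sum]
    refine Finset.sum_congr rfl fun β hβ => ?_
    obtain ⟨hβ, hβ0, hβ1⟩ := hBfin.mem_toFinset.1 hβ
    have hc : D * ∑ i, (1 - β i) = ((k * D - h β : ℤ) : ℝ) := by
      push_cast
      rw [← hh β hβ, Finset.sum_sub_distrib]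
      simp
      ring
    -- Replacing `β` by `1 - β` sends its height `h` to `kD - h`, which is the reflection `t ↦ -k -
    -- t` of `q`.
    have hflip : onMultiples q D (-n - h β) = ε * onMultiples q D (n - (k * D - h β)) := by
      by_cases hd : (D : ℤ) ∣ -n - h β
      · obtain ⟨t, ht⟩ := hd
        rw [ht, show (n : ℤ) - (k * D - h β) = D * (-k - t) by linear_combination - ht,
          onMultiples_mul q hD, onMultiples_mul q hD, hsymm, ← mul_assoc, hε, one_mul]
      · have : ¬ (D : ℤ) ∣ n - (k * D - h β) := fun hd' => hd <| by
          have := dvd_sub (Dvd.intro (-(k : ℤ)) rfl) hd'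
          rwa [show (D : ℤ) * -k - (n - (k * D - h β)) = -n - h β by ring] at this
        simp [onMultiples, hd, this]
    rw [hflip, ← ncard_translates_eq_onMultiples hD hq hneg (fun i => 1 - β i) _ hc n
      (by have := hnonneg β hβ hβ0; omega)]
    congr 3
    ext θ
    constructor
    · rintro ⟨⟨h1, h2, h3⟩, rfl⟩
      refine ⟨⟨fun i => (⌈θ i⌉ - 1).toNat, ?_⟩, h3⟩
      ext i
      have hpos : 0 < ⌈θ i⌉ := Int.ceil_pos.2 (h2 i)
      have : (((⌈θ i⌉ - 1).toNat : ℤ) : ℝ) = (⌈θ i⌉ : ℝ) - 1 := by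
        rw [Int.toNat_of_nonneg (by omega)]
        push_cast
        ring
      rw [Int.cast_natCast] at this
      beta_reduce
      rw [this, ← Int.self_sub_floor, Int.floor_neg]
      push_cast
      ring
    · rintro ⟨⟨m, rfl⟩, h3⟩
      refine ⟨⟨?_, fun i => add_pos_of_pos_of_nonneg (sub_pos.2 (hβ1 i)) (Nat.cast_nonneg _), h3⟩, ?_⟩
      · have := Λ.sub_mem (hZ fun i => 1 + (m i : ℤ)) hβ
        convert this using 1
        ext i
        simp
        ring
      · ext i
        rw [show -(1 - β i + m i) = β i + ((-1 - m i : ℤ) : ℝ) by push_cast; ring,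
          Int.fract_add_intCast, Int.fract_eq_self.2 ⟨hβ0 i, hβ1 i⟩]

theorem ncard_fin_two_sum_eq (t : ℕ) :
    ({m : Fin 2 → ℕ | ∑ i, m i = t}.ncard : ℝ) = (t : ℝ) + 1 := by
  rw [show {m : Fin 2 → ℕ | ∑ i, m i = t} = ↑(Finset.Nat.antidiagonalTuple 2 t) by
    ext m; simp [Finset.Nat.mem_antidiagonalTuple], Set.ncard_coe_finset,
    Finset.Nat.antidiagonalTuple_two]
  simp

theorem ncard_fin_three_sum_eq (t : ℕ) :
    ({m : Fin 3 → ℕ | ∑ i, m i = t}.ncard : ℝ) = ((t : ℝ) + 1) * (t + 2) / 2 := by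
  have hfin : {m : Fin 3 → ℕ | ∑ i, m i = t}.Finite := by
    rw [show {m : Fin 3 → ℕ | ∑ i, m i = t} = ↑(Finset.Nat.antidiagonalTuple 3 t) by
      ext m; simp [Finset.Nat.mem_antidiagonalTuple]]
    exact Finset.finite_toSet _
  rw [ncard_eq_sum_ncard_fibers hfin (t := Finset.range (t + 1)) (fun m => m 0) (by
    intro m hm
    simp only [Set.mem_ofPred_eq, Fin.sum_univ_three] at hm
    simp only [Finset.mem_range]
    omega)]
  push_cast
  have : ∀ j ∈ Finset.range (t + 1),
      ({m : Fin 3 → ℕ | m ∈ {m : Fin 3 → ℕ | ∑ i, m i = t} ∧ m 0 = j}.ncard : ℝ)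
        = ((t - j : ℕ) : ℝ) + 1 := by
    intro j hj
    rw [Finset.mem_range] at hj
    have hinj : Function.Injective fun m : Fin 2 → ℕ => (Fin.cons j m : Fin 3 → ℕ) :=
      Fin.cons_right_injective (α := fun _ : Fin 3 => ℕ) j
    rw [← ncard_fin_two_sum_eq, ← Set.ncard_image_of_injective _ hinj]
    congr 2
    ext m
    constructor
    · rintro ⟨h1, rfl⟩
      refine ⟨Fin.tail m, ?_, Fin.cons_self_tail m⟩
      simp only [Set.mem_ofPred_eq, Fin.sum_univ_succ (n := 2)] at h1 ⊢
      simp only [Fin.tail]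
      omega
    · rintro ⟨m, hm, rfl⟩
      simp only [Set.mem_ofPred_eq] at hm
      refine ⟨?_, rfl⟩
      simp only [Set.mem_ofPred_eq, Fin.sum_univ_succ (n := 2), Fin.cons_zero, Fin.cons_succ]
      omega
  rw [Finset.sum_congr rfl this]
  clear this hfin
  have hrefl := Finset.sum_range_reflect (fun j => ((j : ℕ) : ℝ) + 1) (t + 1)
  simp only [Nat.add_sub_cancel] at hrefl
  rw [hrefl]
  clear hrefl
  induction t with
  | zero => simp
  | succ t ih =>
    rw [Finset.sum_range_succ, ih]
    push_cast
    ring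

/-- The counting polynomials are `t + 1` and `(t + 1)(t + 2)/2`; the reflection `t ↦ -k - t`
multiplies them by `(-1) ^ (k + 1)`. -/
theorem reciprocal_ncard_simplicialCone_of_le_three {k D : ℕ} (hk : k = 2 ∨ k = 3) (hD : 0 < D)
    (Λ : AddSubgroup (Fin k → ℝ)) (hZ : ∀ m : Fin k → ℤ, (fun i => (m i : ℝ)) ∈ Λ)
    (hH : ∀ θ ∈ Λ, ∃ z : ℤ, D * ∑ i, θ i = z)
    (hfin : ∀ n : ℕ, {θ | θ ∈ Λ ∧ (∀ i, 0 ≤ θ i) ∧ D * ∑ i, θ i = n}.Finite) :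
    Reciprocal D
      (fun n => {θ | θ ∈ Λ ∧ (∀ i, 0 ≤ θ i) ∧ D * ∑ i, θ i = n}.ncard)
      (fun n => (-1) ^ (k + 1) * {θ | θ ∈ Λ ∧ (∀ i, 0 < θ i) ∧ D * ∑ i, θ i = n}.ncard) := by
  rcases hk with rfl | rfl
  · refine reciprocal_ncard_simplicialCone (q := fun t => (t : ℝ) + 1) (by norm_num) hD Λ hZ hH
      hfin (by norm_num) (fun t => ?_) (fun t h1 h2 => ?_) (fun t => ?_) ⟨0, 1, 1, fun t => by ring⟩
    · simpa using ncard_fin_two_sum_eq t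
    · obtain rfl : t = -1 := by push_cast at h1; omega
      norm_num
    · push_cast
      ring
  · refine reciprocal_ncard_simplicialCone (q := fun t => ((t : ℝ) + 1) * (t + 2) / 2)
      (by norm_num) hD Λ hZ hH
      hfin (by norm_num) (fun t => ?_) (fun t h1 h2 => ?_) (fun t => ?_)
      ⟨1 / 2, 3 / 2, 1, fun t => by ring⟩
    · simpa using ncard_fin_three_sum_eq t
    · obtain rfl | rfl : t = -1 ∨ t = -2 := by push_cast at h1; omega
      all_goals norm_num
    · push_cast
      ring

/-! ### Lattice points in dilated segments and triangles -/

theorem finite_inter_integerLattice {d : ℕ} {S : Set (Fin d → ℝ)} (hS : Bornology.IsBounded S) :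
    (S ∩ integerLattice d).Finite := by
  obtain ⟨R, hR⟩ := hS.subset_closedBall 0
  refine ((Set.finite_Icc (fun _ : Fin d => -⌈R⌉) (fun _ => ⌈R⌉)).image
    fun z i => ((z i : ℤ) : ℝ)).subset ?_
  rintro x ⟨hx, hxZ⟩
  choose z hz using hxZ
  refine ⟨z, ?_, funext fun i => (hz i).symm⟩
  have h : ∀ i, |(z i : ℝ)| ≤ (⌈R⌉ : ℝ) := fun i => by
    rw [← hz i, ← Real.norm_eq_abs]
    exact (norm_le_pi_norm x i).trans ((mem_closedBall_zero_iff.1 (hR hx)).trans (Int.le_ceil R))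
  constructor <;> intro i
  · exact_mod_cast (abs_le.1 (h i)).1
  · exact_mod_cast (abs_le.1 (h i)).2

theorem mem_convexHull_range_iff {ι E : Type*} [Fintype ι] [AddCommGroup E] [Module ℝ E]
    (v : ι → E) (x : E) :
    x ∈ convexHull ℝ (Set.range v) ↔
      ∃ μ : ι → ℝ, (∀ i, 0 ≤ μ i) ∧ ∑ i, μ i = 1 ∧ ∑ i, μ i • v i = x := by
  constructor
  · intro h
    rw [convexHull_range_eq_exists_affineCombination] at h
    obtain ⟨s, w, h0, h1, rfl⟩ := h
    classical
    refine ⟨fun i => if i ∈ s then w i else 0, fun i => ?_, ?_, ?_⟩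
    · dsimp only
      split_ifs with hi
      exacts [h0 i hi, le_rfl]
    · simpa using h1
    · rw [Finset.affineCombination_eq_linear_combination _ _ _ h1]
      simp [ite_smul]
  · rintro ⟨μ, h0, h1, rfl⟩
    exact (convex_convexHull ℝ _).sum_mem (fun i _ => h0 i) h1
      fun i _ => subset_convexHull ℝ _ ⟨i, rfl⟩

theorem integerLattice_add {d : ℕ} {x y : Fin d → ℝ} (hx : x ∈ integerLattice d)
    (hy : y ∈ integerLattice d) : x + y ∈ integerLattice d := fun i => by
  obtain ⟨a, ha⟩ := hx i
  obtain ⟨b, hb⟩ := hy i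
  exact ⟨a + b, by simp [ha, hb]⟩

theorem integerLattice_neg {d : ℕ} {x : Fin d → ℝ} (hx : x ∈ integerLattice d) :
    -x ∈ integerLattice d := fun i => by
  obtain ⟨a, ha⟩ := hx i
  exact ⟨-a, by simp [ha]⟩

theorem integerLattice_zero {d : ℕ} : (0 : Fin d → ℝ) ∈ integerLattice d :=
  fun _ => ⟨0, by simp⟩

/-- The weights `θ` for which the combination `∑ θᵢ (D vᵢ, D)` of the generators of the cone over
the simplex with vertices `v` is a lattice point. -/
def coneLattice {k : ℕ} (D : ℕ) (v : Fin k → Fin 2 → ℝ) : AddSubgroup (Fin k → ℝ) where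
  carrier := {θ | ∑ i, θ i • ((D : ℝ) • v i) ∈ integerLattice 2 ∧ ∃ z : ℤ, D * ∑ i, θ i = z}
  zero_mem' := ⟨by simpa using integerLattice_zero, 0, by simp⟩
  add_mem' := by
    rintro θ η ⟨h1, a, ha⟩ ⟨h2, b, hb⟩
    refine ⟨?_, a + b, ?_⟩
    · simpa [add_smul, Finset.sum_add_distrib] using integerLattice_add h1 h2
    · simp [Finset.sum_add_distrib, mul_add, ha, hb]
  neg_mem' := by
    rintro θ ⟨h1, a, ha⟩
    refine ⟨?_, -a, ?_⟩
    · simpa [neg_smul] using integerLattice_neg h1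
    · simp [ha]

theorem intCast_mem_coneLattice {k D : ℕ} {v : Fin k → Fin 2 → ℝ}
    (hv : ∀ i, (D : ℝ) • v i ∈ integerLattice 2) (m : Fin k → ℤ) :
    (fun i => (m i : ℝ)) ∈ coneLattice D v := by
  refine ⟨fun j => ?_, D * ∑ i, m i, by push_cast; rfl⟩
  choose z hz using hv
  refine ⟨∑ i, m i * z i j, ?_⟩
  simp only [Finset.sum_apply, Pi.smul_apply (_ : ℝ)] at hz ⊢
  push_cast
  exact Finset.sum_congr rfl fun i _ => by rw [← hz]; rfl

theorem injOn_weights {k D : ℕ} (hD : 0 < D) {v : Fin k → Fin 2 → ℝ} (hv : AffineIndependent ℝ v)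
    (c : ℝ) : Set.InjOn (fun θ : Fin k → ℝ => ∑ i, θ i • ((D : ℝ) • v i))
      {θ | D * ∑ i, θ i = c} := by
  intro θ h1 η h2 h
  have hDR : (0 : ℝ) < D := by exact_mod_cast hD
  have h3 : (D : ℝ) * ∑ i, (θ i - η i) = 0 := by
    rw [Finset.sum_sub_distrib, mul_sub, show D * ∑ i, θ i = c from h1,
      show D * ∑ i, η i = c from h2, sub_self]
  have h4 : (D : ℝ) • ∑ i, (θ i - η i) • v i = 0 := by
    rw [← sub_eq_zero.2 h, ← Finset.sum_sub_distrib, Finset.smul_sum]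
    refine Finset.sum_congr rfl fun i _ => ?_
    simp only [smul_smul, ← sub_smul]
    ring_nf
  ext i
  exact sub_eq_zero.1 (affineIndependent_iff.1 hv Finset.univ _
    ((mul_eq_zero.1 h3).resolve_left hDR.ne') ((smul_eq_zero.1 h4).resolve_left hDR.ne') i
    (Finset.mem_univ _))

/-- Scaling barycentric coordinates by `n / D` turns points of `nC` into weights of height `n`. The
predicate `p` covers closed simplices (`0 ≤ t`) and open ones (`0 < t`) together. -/
theorem ehrhartCount_eq_ncard_weights {k D : ℕ} (hD : 0 < D) {v : Fin k → Fin 2 → ℝ}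
    (hv : AffineIndependent ℝ v) {p : ℝ → Prop} (hp : ∀ c t, 0 < c → p t → p (c * t))
    {C : Set (Fin 2 → ℝ)}
    (hC : ∀ x, x ∈ C ↔ ∃ μ : Fin k → ℝ, (∀ i, p (μ i)) ∧ ∑ i, μ i = 1 ∧ ∑ i, μ i • v i = x)
    {n : ℕ} (hn : 0 < n) :
    ehrhartCount C n = {θ | θ ∈ coneLattice D v ∧ (∀ i, p (θ i)) ∧ D * ∑ i, θ i = n}.ncard := by
  have hDR : (0 : ℝ) < D := by exact_mod_cast hD
  have hnR : (0 : ℝ) < n := by exact_mod_cast hn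
  rw [ehrhartCount, ← ((injOn_weights hD hv n).mono
    (s₁ := {θ | θ ∈ coneLattice D v ∧ (∀ i, p (θ i)) ∧ D * ∑ i, θ i = n})
    fun θ hθ => hθ.2.2).ncard_image]
  congr 1
  ext x
  constructor
  · rintro ⟨⟨y, hy, rfl⟩, hx⟩
    obtain ⟨μ, h0, h1, rfl⟩ := (hC y).1 hy
    have hsum : (D : ℝ) * ∑ i, (n / D : ℝ) * μ i = n := by
      rw [← Finset.mul_sum, h1]
      field_simp
    have heq : ∑ i, ((n / D : ℝ) * μ i) • ((D : ℝ) • v i) = (n : ℝ) • ∑ i, μ i • v i := by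
      rw [Finset.smul_sum]
      refine Finset.sum_congr rfl fun i _ => ?_
      rw [smul_smul, smul_smul]
      congr 1
      field_simp
    refine ⟨fun i => (n / D : ℝ) * μ i, ⟨⟨?_, n, ?_⟩, fun i => hp _ _ (by positivity) (h0 i), hsum⟩,
      heq⟩
    · rw [heq]
      exact hx
    · exact_mod_cast hsum
  · rintro ⟨θ, ⟨h1, h2, h3⟩, rfl⟩
    refine ⟨⟨∑ i, ((D / n : ℝ) * θ i) • v i, (hC _).2 ⟨fun i => (D / n : ℝ) * θ i,
      fun i => hp _ _ (by positivity) (h2 i), ?_, rfl⟩, ?_⟩, h1.1⟩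
    · rw [← Finset.mul_sum, div_mul_eq_mul_div, h3, div_self hnR.ne']
    · simp only [Finset.smul_sum]
      refine Finset.sum_congr rfl fun i _ => ?_
      rw [smul_smul, smul_smul]
      congr 1
      field_simp

theorem ehrhartCount_zero {C : Set (Fin 2 → ℝ)} (hC : C.Nonempty) : ehrhartCount C 0 = 1 := by
  rw [ehrhartCount, Nat.cast_zero, Set.zero_smul_set hC, Set.inter_eq_left.2, Set.ncard_eq_one]
  · exact ⟨0, rfl⟩
  · rintro _ rfl
    exact integerLattice_zero

/-- Ehrhart–Macdonald reciprocity for segments and triangles with vertices in `(1/D)ℤ²`. -/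
theorem reciprocal_ehrhartCount_simplex {k D : ℕ} (hk : k = 2 ∨ k = 3) (hD : 0 < D)
    {v : Fin k → Fin 2 → ℝ} (hv : AffineIndependent ℝ v)
    (hint : ∀ i, (D : ℝ) • v i ∈ integerLattice 2) {O : Set (Fin 2 → ℝ)}
    (hO : ∀ x, x ∈ O ↔ ∃ μ : Fin k → ℝ, (∀ i, 0 < μ i) ∧ ∑ i, μ i = 1 ∧ ∑ i, μ i • v i = x) :
    Reciprocal D (fun n => ehrhartCount (convexHull ℝ (Set.range v)) n)
      (fun n => (-1) ^ (k + 1) * ehrhartCount O n) := by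
  have hDR : (0 : ℝ) < D := by exact_mod_cast hD
  have hne : (convexHull ℝ (Set.range v)).Nonempty := by
    have : Nonempty (Fin k) := ⟨⟨0, by omega⟩⟩
    exact (Set.range_nonempty v).convexHull
  have hzero : {θ | θ ∈ coneLattice D v ∧ (∀ i, 0 ≤ θ i) ∧ D * ∑ i, θ i = (0 : ℕ)} = {0} := by
    ext θ
    constructor
    · rintro ⟨-, h0, h1⟩
      rw [Nat.cast_zero, mul_eq_zero, or_iff_right hDR.ne',
        Finset.sum_eq_zero_iff_of_nonneg fun i _ => h0 i] at h1
      exact funext fun i => h1 i (Finset.mem_univ _)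
    · rintro rfl
      exact ⟨zero_mem _, fun i => le_rfl, by simp⟩
  have hfin : ∀ n : ℕ, {θ | θ ∈ coneLattice D v ∧ (∀ i, 0 ≤ θ i) ∧ D * ∑ i, θ i = n}.Finite := by
    intro n
    rcases Nat.eq_zero_or_pos n with rfl | hn
    · rw [hzero]
      exact Set.finite_singleton _
    have hnR : (0 : ℝ) < n := by exact_mod_cast hn
    refine Set.Finite.of_finite_image
      (f := fun θ : Fin k → ℝ => ∑ i, θ i • ((D : ℝ) • v i)) ?_
      ((injOn_weights hD hv n).mono fun θ hθ => hθ.2.2)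
    refine (finite_inter_integerLattice (((isBounded_convexHull (s := Set.range v)).2
      (Set.finite_range v).isBounded).smul₀ (n : ℝ))).subset ?_
    rintro _ ⟨θ, ⟨h1, h2, h3⟩, rfl⟩
    refine ⟨⟨∑ i, ((D / n : ℝ) * θ i) • v i, (mem_convexHull_range_iff v _).2
      ⟨fun i => (D / n : ℝ) * θ i, fun i => mul_nonneg (by positivity) (h2 i), ?_, rfl⟩, ?_⟩, h1.1⟩
    · rw [← Finset.mul_sum, div_mul_eq_mul_div, h3, div_self hnR.ne']
    · simp only [Finset.smul_sum]
      refine Finset.sum_congr rfl fun i _ => ?_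
      rw [smul_smul, smul_smul]
      congr 1
      field_simp
  refine (reciprocal_ncard_simplicialCone_of_le_three hk hD (coneLattice D v)
    (intCast_mem_coneLattice hint) (fun θ hθ => hθ.2) hfin).congr (fun n => ?_) (fun n hn => ?_)
  · rcases Nat.eq_zero_or_pos n with rfl | hn
    · rw [hzero, ehrhartCount_zero hne, Set.ncard_singleton]
    · rw [ehrhartCount_eq_ncard_weights hD hv (p := fun t => 0 ≤ t)
        (fun c t hc ht => mul_nonneg hc.le ht) (mem_convexHull_range_iff v) hn]
  · rw [ehrhartCount_eq_ncard_weights hD hv (p := fun t => 0 < t)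
        (fun c t hc ht => mul_pos hc ht) hO hn]

theorem reciprocal_ehrhartCount_segment {D : ℕ} (hD : 0 < D) {v w : Fin 2 → ℝ} (hvw : v ≠ w)
    (hv : (D : ℝ) • v ∈ integerLattice 2) (hw : (D : ℝ) • w ∈ integerLattice 2) :
    Reciprocal D (fun n => ehrhartCount (segment ℝ v w) n)
      (fun n => -(ehrhartCount (openSegment ℝ v w) n : ℝ)) := by
  have := reciprocal_ehrhartCount_simplex (Or.inl rfl) hD (affineIndependent_of_ne ℝ hvw)
    (by intro i; fin_cases i <;> simpa) (O := openSegment ℝ v w) (fun x => by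
      constructor
      · rintro ⟨a, b, ha, hb, hab, rfl⟩
        exact ⟨![a, b], by simp [Fin.forall_fin_two, ha, hb], by simpa, by simp⟩
      · rintro ⟨μ, h0, h1, rfl⟩
        exact ⟨μ 0, μ 1, h0 0, h0 1, by simpa using h1, by simp⟩)
  rw [Matrix.range_cons_cons_empty, convexHull_pair] at this
  exact this.congr (fun n => rfl) (fun n _ => by ring)

theorem reciprocal_ehrhartCount_triangle {D : ℕ} (hD : 0 < D) {v : Fin 3 → Fin 2 → ℝ}
    (hv : AffineIndependent ℝ v) (hint : ∀ i, (D : ℝ) • v i ∈ integerLattice 2) :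
    Reciprocal D (fun n => ehrhartCount (convexHull ℝ (Set.range v)) n)
      (fun n => ehrhartCount (interior (convexHull ℝ (Set.range v))) n) := by
  have htop : affineSpan ℝ (Set.range v) = ⊤ :=
    hv.affineSpan_eq_top_iff_card_eq_finrank_add_one.2 (by simp)
  let b : AffineBasis (Fin 3) ℝ (Fin 2 → ℝ) := ⟨v, hv, htop⟩
  refine (reciprocal_ehrhartCount_simplex (Or.inr rfl) hD hv hint
    (O := interior (convexHull ℝ (Set.range v))) fun x => ?_).congr (fun n => rfl)
    (fun n _ => by ring)
  change x ∈ interior (convexHull ℝ (Set.range b)) ↔ _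
  rw [b.interior_convexHull]
  constructor
  · intro h
    exact ⟨fun i => b.coord i x, h, b.sum_coord_apply_eq_one x, b.linear_combination_coord_eq_self x⟩
  · rintro ⟨μ, h0, h1, rfl⟩ i
    have h := b.coord_apply_combination_of_mem (Finset.mem_univ i) h1
    rw [Finset.affineCombination_eq_linear_combination _ _ _ h1] at h
    change 0 < b.coord i (∑ i, μ i • b i)
    rw [h]
    exact h0 i

/-! ### Cutting a convex polygon along a diagonal -/

theorem ehrhartCount_union_add_inter {A B : Set (Fin 2 → ℝ)} (hA : Bornology.IsBounded A)
    (hB : Bornology.IsBounded B) {n : ℕ} (hn : n ≠ 0) :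
    ehrhartCount (A ∪ B) n + ehrhartCount (A ∩ B) n = ehrhartCount A n + ehrhartCount B n := by
  have hn' : (n : ℝ) ≠ 0 := by exact_mod_cast hn
  simp only [ehrhartCount, Set.smul_set_inter₀ hn', Set.smul_set_union]
  rw [Set.union_inter_distrib_right, Set.inter_inter_distrib_right,
    Set.ncard_union_add_ncard_inter _ _ (finite_inter_integerLattice (hA.smul₀ _))
      (finite_inter_integerLattice (hB.smul₀ _))]

theorem ehrhartCount_union {A B : Set (Fin 2 → ℝ)} (hA : Bornology.IsBounded A)
    (hB : Bornology.IsBounded B) (hAB : A ∩ B = ∅) {n : ℕ} (hn : n ≠ 0) :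
    ehrhartCount (A ∪ B) n = ehrhartCount A n + ehrhartCount B n := by
  rw [← ehrhartCount_union_add_inter hA hB hn, hAB]
  simp [ehrhartCount]

theorem subset_extremePoints_convexHull_mono {E : Type*} [AddCommGroup E] [Module ℝ E]
    {V W : Set E} (hV : V ⊆ (convexHull ℝ V).extremePoints ℝ) (hW : W ⊆ V) :
    W ⊆ (convexHull ℝ W).extremePoints ℝ := fun _ hx =>
  inter_extremePoints_subset_extremePoints_of_subset (convexHull_mono hW)
    ⟨subset_convexHull ℝ W hx, hV (hW hx)⟩

/-- A finite set of at least four points in convex position in the plane has two points whose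
connecting line, here the zero set of `f`, strictly separates two other points. -/
theorem exists_separating_diagonal {V : Set (Fin 2 → ℝ)}
    (hV : V ⊆ (convexHull ℝ V).extremePoints ℝ) (hspan : affineSpan ℝ V = ⊤)
    (hdep : ¬ AffineIndependent ℝ ((↑) : V → Fin 2 → ℝ)) :
    ∃ (f : (Fin 2 → ℝ) →ᵃ[ℝ] ℝ) (v w a b : Fin 2 → ℝ), v ∈ V ∧ w ∈ V ∧ a ∈ V ∧ b ∈ V ∧
      v ≠ w ∧ f v = 0 ∧ f w = 0 ∧ 0 < f a ∧ f b < 0 ∧ Continuous f ∧ IsOpenMap f ∧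
      ∀ p, f p = 0 → ∃ s : ℝ, p = (1 - s) • v + s • w := by
  obtain ⟨t, htV, htspan, hti⟩ := exists_affineIndependent ℝ (Fin 2 → ℝ) V
  have htne : t ≠ V := by
    rintro rfl
    exact hdep hti
  obtain ⟨x, hxV, hxt⟩ := Set.exists_of_ssubset (htV.ssubset_of_ne htne)
  have hxconv : x ∉ convexHull ℝ t := fun hx => hxt <| extremePoints_convexHull_subset
    (inter_extremePoints_subset_extremePoints_of_subset (convexHull_mono htV) ⟨hx, hV hxV⟩)
  have : Finite t := finite_set_of_fin_dim_affineIndependent ℝ hti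
  have : Fintype t := Fintype.ofFinite t
  have hcard : Fintype.card t = 3 := by
    have := (AffineIndependent.affineSpan_eq_top_iff_card_eq_finrank_add_one hti).1 (by
      rw [Subtype.range_coe, htspan, hspan])
    simpa using this
  let e : Fin 3 ≃ t := (Fintype.equivFinOfCardEq hcard).symm
  let b : AffineBasis (Fin 3) ℝ (Fin 2 → ℝ) := ⟨fun i => (e i : Fin 2 → ℝ),
    hti.comp_embedding e.toEmbedding, by
      rw [show Set.range (fun i => (e i : Fin 2 → ℝ)) = t by
        rw [show (fun i => (e i : Fin 2 → ℝ)) = Subtype.val ∘ e from rfl, e.surjective.range_comp,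
          Subtype.range_coe], htspan, hspan]⟩
  have hbt : ∀ i, b i ∈ t := fun i => (e i).2
  have hrange : Set.range b = t := by
    rw [show (b : Fin 3 → Fin 2 → ℝ) = Subtype.val ∘ e from rfl, e.surjective.range_comp,
          Subtype.range_coe]
  -- The vertex `x` lies outside the triangle `b`, so one of its barycentric coordinates is
  -- negative. That coordinate serves as `f`: it vanishes on the opposite edge and is `1` at its own
  -- vertex.
  rw [← hrange, b.convexHull_eq_nonneg_coord] at hxconv
  obtain ⟨i, hi⟩ : ∃ i, b.coord i x < 0 := by
    by_contra! h
    exact hxconv h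
  refine ⟨b.coord i, b (i + 1), b (i + 2), b i, x, htV (hbt _), htV (hbt _), htV (hbt _), hxV,
    ?_, ?_, ?_, ?_, hi, continuous_barycentric_coord b i, isOpenMap_barycentric_coord b i, ?_⟩
  · intro h
    have := b.ind.injective h
    fin_cases i <;> simp at this
  · exact b.coord_apply_ne (by fin_cases i <;> simp)
  · exact b.coord_apply_ne (by fin_cases i <;> simp)
  · simp
  · intro p hp
    refine ⟨b.coord (i + 2) p, ?_⟩
    have h1 := b.sum_coord_apply_eq_one p
    have h2 := b.linear_combination_coord_eq_self p
    have huniv : ∀ {M : Type} [AddCommMonoid M] (g : Fin 3 → M),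
        ∑ j, g j = g i + g (i + 1) + g (i + 2) := by
      intro M _ g
      rw [Fin.sum_univ_three]
      fin_cases i
      · rfl
      · change _ = g 1 + g 2 + g 0
        abel
      · change _ = g 2 + g 0 + g 1
        abel
    rw [huniv, hp, zero_add] at h1
    rw [huniv, hp, zero_smul, zero_add] at h2
    rw [← h1, add_sub_cancel_right, h2]

/-- A point of `P` on the line beyond `v` or `w` would put that extreme point strictly inside a
segment of `P`. -/
theorem mem_segment_of_mem_line {E : Type*} [AddCommGroup E] [Module ℝ E] {P : Set E} {v w : E}
    (hv : v ∈ P.extremePoints ℝ) (hw : w ∈ P.extremePoints ℝ) (hvw : v ≠ w) {s : ℝ}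
    (hp : (1 - s) • v + s • w ∈ P) : 0 ≤ s ∧ s ≤ 1 := by
  constructor <;> by_contra! hs
  · refine hvw.symm ((mem_extremePoints.1 hv).2 w hw.1 _ hp ?_).1
    have h1 : (0 : ℝ) < 1 - s := by linarith
    refine ⟨-s / (1 - s), 1 / (1 - s), div_pos (by linarith) h1, by positivity, ?_, ?_⟩
    · field_simp
      ring
    · match_scalars <;> field_simp
      ring
  · refine hvw ((mem_extremePoints.1 hw).2 v hv.1 _ hp ?_).1
    have h1 : 0 < s := by linarith
    refine ⟨(s - 1) / s, 1 / s, div_pos (by linarith) h1, by positivity, ?_, ?_⟩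
    · field_simp
      ring
    · match_scalars <;> field_simp
      ring

theorem convexHull_inter_halfSpace {E : Type*} [AddCommGroup E] [Module ℝ E] {V : Set E}
    (f : E →ᵃ[ℝ] ℝ) {v w : E} (hv : v ∈ V) (hw : w ∈ V) (hfv : f v = 0) (hfw : f w = 0)
    (hline : ∀ p ∈ convexHull ℝ V, f p = 0 → p ∈ segment ℝ v w) :
    convexHull ℝ V ∩ {x | f x ≤ 0} = convexHull ℝ (V ∩ {x | f x ≤ 0}) := by
  have hvl : v ∈ V ∩ {x | f x ≤ 0} := ⟨hv, hfv.le⟩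
  have hwl : w ∈ V ∩ {x | f x ≤ 0} := ⟨hw, hfw.le⟩
  have hvr : v ∈ V ∩ {x | 0 ≤ f x} := ⟨hv, hfv.ge⟩
  have hconvl : Convex ℝ {x | f x ≤ 0} := (convex_Iic (0 : ℝ)).affine_preimage f
  have hconvr : Convex ℝ {x | 0 ≤ f x} := (convex_Ici (0 : ℝ)).affine_preimage f
  apply Set.Subset.antisymm
  · rintro x ⟨hx, hfx⟩
    have hVu : V = V ∩ {x | f x ≤ 0} ∪ V ∩ {x | 0 ≤ f x} := by
      ext y
      have := le_total (f y) 0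
      simp only [Set.mem_union, Set.mem_inter_iff, Set.mem_ofPred_eq]
      tauto
    have hx' := hx
    rw [hVu, convexHull_union ⟨v, hvl⟩ ⟨v, hvr⟩, mem_convexJoin] at hx'
    obtain ⟨y, hy, z, hz, hxyz⟩ := hx'
    have hfy : f y ≤ 0 := convexHull_min Set.inter_subset_right hconvl hy
    have hfz : 0 ≤ f z := convexHull_min Set.inter_subset_right hconvr hz
    rw [segment_eq_image_lineMap] at hxyz
    obtain ⟨s, ⟨hs0, hs1⟩, rfl⟩ := hxyz
    have hcl : Convex ℝ (convexHull ℝ (V ∩ {x | f x ≤ 0})) := convex_convexHull ℝ _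
    have hseg : segment ℝ v w ⊆ convexHull ℝ (V ∩ {x | f x ≤ 0}) :=
      hcl.segment_subset (subset_convexHull ℝ _ hvl) (subset_convexHull ℝ _ hwl)
    have hyV := convexHull_mono (Set.inter_subset_left) hy
    have hzV := convexHull_mono (Set.inter_subset_left) hz
    rw [Set.mem_ofPred_eq, AffineMap.apply_lineMap, AffineMap.lineMap_apply_ring'] at hfx
    rcases hfz.eq_or_lt with hfz0 | hfz0
    · refine hcl.segment_subset hy (hseg (hline z hzV hfz0.symm)) ?_
      rw [segment_eq_image_lineMap]
      exact ⟨s, ⟨hs0, hs1⟩, rfl⟩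
    · have hd : 0 < f z - f y := by linarith
      -- The parameter where the segment from `y` to `z` crosses `f = 0`. The crossing point lies in
      -- `segment ℝ v w`, and `x` lies between `y` and it.
      set t := -f y / (f z - f y) with ht
      have ht0 : 0 ≤ t := div_nonneg (by linarith) hd.le
      have ht1 : t ≤ 1 := (div_le_one hd).2 (by linarith)
      have hst : s ≤ t := (le_div_iff₀ hd).2 (by linarith)
      have hu : AffineMap.lineMap y z t ∈ segment ℝ v w := by
        refine hline _ ((convex_convexHull ℝ V).segment_subset hyV hzV ?_) ?_
        · rw [segment_eq_image_lineMap]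
          exact ⟨t, ⟨ht0, ht1⟩, rfl⟩
        · rw [AffineMap.apply_lineMap, AffineMap.lineMap_apply_ring', ht]
          field_simp
          ring
      refine hcl.segment_subset hy (hseg hu) ?_
      rw [segment_eq_image_lineMap]
      -- If `t = 0` then `s = 0`, and the convention `s / 0 = 0` still gives the right parameter.
      refine ⟨s / t, ⟨by positivity, div_le_one_of_le₀ hst ht0⟩, ?_⟩
      rcases ht0.eq_or_lt with h0 | h0
      · have : s = 0 := by linarith
        simp [this]
      · simp only [AffineMap.lineMap_apply_module']
        clear_value t
        match_scalars <;> field_simp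
        ring
  · exact Set.subset_inter (convexHull_mono Set.inter_subset_left)
      (convexHull_min Set.inter_subset_right hconvl)

/-- Joining `y` to `z` yields an interior point on the line; joining that point to `v` and to `w`
makes the whole open segment interior. The endpoints, being extreme, are not interior. -/
theorem interior_inter_line_eq_openSegment {P : Set (Fin 2 → ℝ)} (hP : Convex ℝ P)
    (f : (Fin 2 → ℝ) →ᵃ[ℝ] ℝ) {v w y z : Fin 2 → ℝ}
    (hv : v ∈ P.extremePoints ℝ) (hw : w ∈ P.extremePoints ℝ) (hvw : v ≠ w)
    (hfv : f v = 0) (hfw : f w = 0) (hline : ∀ p, f p = 0 → ∃ s : ℝ, p = (1 - s) • v + s • w)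
    (hy : y ∈ interior P) (hz : z ∈ interior P) (hfy : f y < 0) (hfz : 0 < f z) :
    interior P ∩ {x | f x = 0} = openSegment ℝ v w := by
  have hnot : ∀ u ∈ P.extremePoints ℝ, u ∉ interior P := fun u hu hu' =>
    Set.disjoint_left.1 (disjoint_interior_extremePoints P) hu' hu
  apply Set.Subset.antisymm
  · rintro p ⟨hp, hfp⟩
    obtain ⟨s, rfl⟩ := hline p hfp
    obtain ⟨h0, h1⟩ := mem_segment_of_mem_line hv hw hvw (interior_subset hp)
    have h0' : s ≠ 0 := by
      rintro rfl
      exact hnot v hv (by simpa using hp)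
    have h1' : s ≠ 1 := by
      rintro rfl
      exact hnot w hw (by simpa using hp)
    exact ⟨1 - s, s, sub_pos.2 (lt_of_le_of_ne h1 h1'), lt_of_le_of_ne h0 h0'.symm, by ring, rfl⟩
  · rintro p ⟨a, r, ha, hr, har, rfl⟩
    obtain rfl : a = 1 - r := by linarith
    have hd : 0 < f z - f y := by linarith
    have hx : AffineMap.lineMap y z (-f y / (f z - f y)) ∈ interior P := by
      refine hP.interior.segment_subset hy hz ?_
      rw [segment_eq_image_lineMap]
      exact ⟨_, ⟨div_nonneg (by linarith) hd.le, (div_le_one hd).2 (by linarith)⟩, rfl⟩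
    obtain ⟨s, hs⟩ := hline (AffineMap.lineMap y z (-f y / (f z - f y))) (by
      rw [AffineMap.apply_lineMap, AffineMap.lineMap_apply_ring']
      field_simp
      ring)
    rw [hs] at hx
    refine ⟨?_, ?_⟩
    · rcases lt_trichotomy r s with h | rfl | h
      · refine hP.openSegment_self_interior_subset_interior hv.1 hx ?_
        have hs0 : 0 < s := hr.trans h
        refine ⟨1 - r / s, r / s, sub_pos.2 ((div_lt_one hs0).2 h), by positivity, by ring, ?_⟩
        match_scalars <;> field_simp
        ring
      · exact hx
      · refine hP.openSegment_self_interior_subset_interior hw.1 hx ?_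
        have hs0 : 0 < 1 - s := by linarith
        refine ⟨1 - (1 - r) / (1 - s), (1 - r) / (1 - s),
          sub_pos.2 ((div_lt_one hs0).2 (by linarith)), by positivity, by ring, ?_⟩
        match_scalars <;> field_simp
        ring
    · have : (1 - r) • v + r • w = AffineMap.lineMap v w r := by
        rw [AffineMap.lineMap_apply_module]
      rw [Set.mem_ofPred_eq, this, AffineMap.apply_lineMap, hfv, hfw]
      simp

/-- Ehrhart–Macdonald reciprocity for convex polygons with vertices in `(1/D)ℤ²`. -/
theorem reciprocal_ehrhartCount_convexHull {D : ℕ} (hD : 0 < D) (N : ℕ) :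
    ∀ V : Set (Fin 2 → ℝ), V.Finite → V.ncard = N →
      V ⊆ (convexHull ℝ V).extremePoints ℝ → (∀ v ∈ V, (D : ℝ) • v ∈ integerLattice 2) →
      (interior (convexHull ℝ V)).Nonempty →
      Reciprocal D (fun n => ehrhartCount (convexHull ℝ V) n)
        (fun n => ehrhartCount (interior (convexHull ℝ V)) n) := by
  induction N using Nat.strong_induction_on with
  | _ N ih =>
  intro V hfin hN hV hint hne
  have hspan : affineSpan ℝ V = ⊤ := interior_convexHull_nonempty_iff_affineSpan_eq_top.1 hne
  by_cases hdep : AffineIndependent ℝ ((↑) : V → Fin 2 → ℝ)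
  · have : Fintype V := hfin.fintype
    have hcard : Fintype.card V = 3 := by
      have := (AffineIndependent.affineSpan_eq_top_iff_card_eq_finrank_add_one hdep).1 (by
        rw [Subtype.range_coe, hspan])
      simpa using this
    let e : Fin 3 ≃ V := (Fintype.equivFinOfCardEq hcard).symm
    have hrange : Set.range (Subtype.val ∘ e) = V := by
      rw [e.surjective.range_comp, Subtype.range_coe]
    have := reciprocal_ehrhartCount_triangle hD (hdep.comp_embedding e.toEmbedding)
      (fun i => hint _ (e i).2)
    change Reciprocal D (fun n => ehrhartCount (convexHull ℝ (Set.range (Subtype.val ∘ e))) n) (fun n =>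
      ehrhartCount (interior (convexHull ℝ (Set.range (Subtype.val ∘ e)))) n) at this
    rwa [hrange] at this
  obtain ⟨f, v, w, a, b, hvV, hwV, haV, hbV, hvw, hfv, hfw, hfa, hfb, hcont, hopen, hline⟩ :=
    exists_separating_diagonal hV hspan hdep
  set P := convexHull ℝ V with hPdef
  have hP : Convex ℝ P := convex_convexHull ℝ V
  have hbdd : Bornology.IsBounded P := isBounded_convexHull.2 hfin.isBounded
  have hseg : ∀ p ∈ P, f p = 0 → p ∈ segment ℝ v w := by
    intro p hp hfp
    obtain ⟨s, rfl⟩ := hline p hfp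
    obtain ⟨h0, h1⟩ := mem_segment_of_mem_line (hV hvV) (hV hwV) hvw hp
    exact ⟨1 - s, s, sub_nonneg.2 h1, h0, by ring, rfl⟩
  have hl : P ∩ {x | f x ≤ 0} = convexHull ℝ (V ∩ {x | f x ≤ 0}) :=
    convexHull_inter_halfSpace f hvV hwV hfv hfw hseg
  have hr : P ∩ {x | 0 ≤ f x} = convexHull ℝ (V ∩ {x | 0 ≤ f x}) := by
    have := convexHull_inter_halfSpace (-f) hvV hwV (by simp [hfv]) (by simp [hfw])
      (fun p hp h => hseg p hp (by simpa using h))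
    simpa using this
  have hintl : interior (P ∩ {x | f x ≤ 0}) = interior P ∩ {x | f x < 0} := by
    rw [interior_inter, show {x | f x ≤ 0} = f ⁻¹' Set.Iic 0 from rfl,
      ← hopen.preimage_interior_eq_interior_preimage hcont, interior_Iic]
    rfl
  have hintr : interior (P ∩ {x | 0 ≤ f x}) = interior P ∩ {x | 0 < f x} := by
    rw [interior_inter, show {x | 0 ≤ f x} = f ⁻¹' Set.Ici 0 from rfl,
      ← hopen.preimage_interior_eq_interior_preimage hcont, interior_Ici]
    rfl
  have hclosure : ∀ x ∈ V, x ∈ closure (interior P) := fun x hx => by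
    rw [hP.closure_interior_eq_closure_of_nonempty_interior hne]
    exact subset_closure (subset_convexHull ℝ V hx)
  -- Vertices are limits of interior points, so both pieces have non-empty interior.
  obtain ⟨y, hfy, hy⟩ : ({x | f x < 0} ∩ interior P).Nonempty :=
    mem_closure_iff.1 (hclosure b hbV) _ (isOpen_lt hcont continuous_const) hfb
  obtain ⟨z, hfz, hz⟩ : ({x | 0 < f x} ∩ interior P).Nonempty :=
    mem_closure_iff.1 (hclosure a haV) _ (isOpen_lt continuous_const hcont) hfa
  have hmid := interior_inter_line_eq_openSegment hP f (hV hvV) (hV hwV) hvw hfv hfw hline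
    hy hz hfy hfz
  have hvP : v ∈ P := subset_convexHull ℝ V hvV
  have hwP : w ∈ P := subset_convexHull ℝ V hwV
  have hsegP : segment ℝ v w = P ∩ {x | f x ≤ 0} ∩ (P ∩ {x | 0 ≤ f x}) := by
    apply Set.Subset.antisymm
    · intro p hp
      have hfp : f p = 0 := by
        rw [segment_eq_image_lineMap] at hp
        obtain ⟨s, -, rfl⟩ := hp
        rw [AffineMap.apply_lineMap, hfv, hfw]
        simp
      have hpP := hP.segment_subset hvP hwP hp
      exact ⟨⟨hpP, hfp.le⟩, hpP, hfp.ge⟩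
    · rintro p ⟨⟨hp, h1⟩, -, h2⟩
      exact hseg p hp (le_antisymm h1 h2)
  have hunion : P = P ∩ {x | f x ≤ 0} ∪ P ∩ {x | 0 ≤ f x} := by
    rw [← Set.inter_union_distrib_left, eq_comm, Set.inter_eq_left]
    exact fun x _ => le_total (f x) 0
  have hintunion : interior P = interior P ∩ {x | f x < 0} ∪ interior P ∩ {x | 0 < f x} ∪
      interior P ∩ {x | f x = 0} := by
    ext x
    have := lt_trichotomy (f x) 0
    simp only [Set.mem_union, Set.mem_inter_iff, Set.mem_ofPred_eq]
    tauto
  have hcardl : (V ∩ {x | f x ≤ 0}).ncard < N := by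
    rw [← hN]
    exact Set.ncard_lt_ncard ⟨Set.inter_subset_left, fun h => hfa.not_ge (h haV).2⟩ hfin
  have hcardr : (V ∩ {x | 0 ≤ f x}).ncard < N := by
    rw [← hN]
    exact Set.ncard_lt_ncard ⟨Set.inter_subset_left, fun h => hfb.not_ge (h hbV).2⟩ hfin
  have Rl := ih _ hcardl _ (hfin.subset Set.inter_subset_left) rfl
    (subset_extremePoints_convexHull_mono hV Set.inter_subset_left) (fun v hv => hint v hv.1)
    (by rw [← hl, hintl]; exact ⟨y, hy, hfy⟩)
  have Rr := ih _ hcardr _ (hfin.subset Set.inter_subset_left) rfl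
    (subset_extremePoints_convexHull_mono hV Set.inter_subset_left) (fun v hv => hint v hv.1)
    (by rw [← hr, hintr]; exact ⟨z, hz, hfz⟩)
  rw [← hl, hintl] at Rl
  rw [← hr, hintr] at Rr
  have Rs := reciprocal_ehrhartCount_segment hD hvw (hint v hvV) (hint w hwV)
  -- The closed pieces overlap in the diagonal, which is subtracted; the open pieces miss the open
  -- diagonal, which must be added. The minus sign in reciprocity for segments reconciles the two.
  refine ((Rl.add Rr).sub Rs).congr (fun n => ?_) (fun n hn => ?_)
  · rcases Nat.eq_zero_or_pos n with rfl | hn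
    · have h1 : (P ∩ {x | f x ≤ 0}).Nonempty := ⟨v, hvP, hfv.le⟩
      have h2 : (P ∩ {x | 0 ≤ f x}).Nonempty := ⟨v, hvP, hfv.ge⟩
      rw [ehrhartCount_zero ⟨v, hvP⟩, ehrhartCount_zero h1, ehrhartCount_zero h2,
        ehrhartCount_zero ⟨v, left_mem_segment ℝ v w⟩]
      norm_num
    · have := ehrhartCount_union_add_inter (hbdd.subset Set.inter_subset_left)
        (hbdd.subset Set.inter_subset_left) hn.ne' (A := P ∩ {x | f x ≤ 0})
        (B := P ∩ {x | 0 ≤ f x})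
      rw [← hunion, ← hsegP] at this
      rw [eq_sub_iff_add_eq]
      exact_mod_cast this
  · have hb' := hbdd.subset (interior_subset (s := P))
    have h1 : ehrhartCount (interior P) n =
        ehrhartCount (interior P ∩ {x | f x < 0} ∪ interior P ∩ {x | 0 < f x}) n +
          ehrhartCount (interior P ∩ {x | f x = 0}) n := by
      conv_lhs => rw [hintunion]
      exact ehrhartCount_union ((hb'.subset Set.inter_subset_left).union
        (hb'.subset Set.inter_subset_left)) (hb'.subset Set.inter_subset_left) (by
          ext x
          simp only [Set.mem_union, Set.mem_inter_iff, Set.mem_ofPred_eq, Set.mem_empty_iff_false,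
            iff_false]
          rintro ⟨⟨-, h⟩ | ⟨-, h⟩, -, h'⟩ <;> linarith) (by omega)
    have h2 := ehrhartCount_union (A := interior P ∩ {x | f x < 0})
      (B := interior P ∩ {x | 0 < f x}) (hb'.subset Set.inter_subset_left)
      (hb'.subset Set.inter_subset_left) (by
          ext x
          simp only [Set.mem_inter_iff, Set.mem_ofPred_eq, Set.mem_empty_iff_false, iff_false]
          rintro ⟨⟨-, h⟩, -, h'⟩
          linarith) (n := n) (by omega)
    rw [h2, hmid] at h1
    rw [h1]
    push_cast
    ring

/-! ### Vertices and denominators of polytopes -/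

theorem extremePoints_smul {d : ℕ} {c : ℝ} (hc : c ≠ 0) (P : Set (Fin d → ℝ)) :
    (c • P).extremePoints ℝ = c • P.extremePoints ℝ :=
  (image_extremePoints (LinearEquiv.smulOfNeZero ℝ (Fin d → ℝ) c hc) P).symm

theorem IsPolytope.smul {d : ℕ} {P : Set (Fin d → ℝ)} (hP : IsPolytope P) (c : ℝ) :
    IsPolytope (c • P) := by
  obtain ⟨V, hV, rfl⟩ := hP
  exact ⟨c • V, hV.smul_set, (convexHull_smul c V).symm⟩

theorem IsPolytope.finite_extremePoints {d : ℕ} {P : Set (Fin d → ℝ)} (hP : IsPolytope P) :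
    (P.extremePoints ℝ).Finite := by
  obtain ⟨V, hV, rfl⟩ := hP
  exact hV.subset extremePoints_convexHull_subset

theorem IsPolytope.isCompact {d : ℕ} {P : Set (Fin d → ℝ)} (hP : IsPolytope P) : IsCompact P := by
  obtain ⟨V, hV, rfl⟩ := hP
  exact hV.isCompact_convexHull (𝕜 := ℝ)

theorem IsPolytope.convex {d : ℕ} {P : Set (Fin d → ℝ)} (hP : IsPolytope P) : Convex ℝ P := by
  obtain ⟨V, -, rfl⟩ := hP
  exact convex_convexHull ℝ V

theorem IsPolytope.convexHull_extremePoints {d : ℕ} {P : Set (Fin d → ℝ)} (hP : IsPolytope P) :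
    convexHull ℝ (P.extremePoints ℝ) = P := by
  rw [← (hP.finite_extremePoints.isClosed_convexHull (𝕜 := ℝ)).closure_eq,
    closure_convexHull_extremePoints hP.isCompact hP.convex]

theorem IsRationalPolytope.exists_isIntegralPolytope_smul {d : ℕ} {P : Set (Fin d → ℝ)}
    (hP : IsRationalPolytope P) : ∃ n : ℕ, 0 < n ∧ IsIntegralPolytope ((n : ℝ) • P) := by
  choose! q hq using hP.2
  have hfin := hP.1.finite_extremePoints
  set N := ∏ v ∈ hfin.toFinset, ∏ i, (q v i).den with hN
  have hpos : 0 < N := Finset.prod_pos fun v _ => Finset.prod_pos fun i _ => (q v i).den_pos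
  refine ⟨N, hpos, hP.1.smul _, ?_⟩
  rw [extremePoints_smul (by exact_mod_cast hpos.ne')]
  rintro _ ⟨v, hv, rfl⟩ i
  obtain ⟨c, hc⟩ : (q v i).den ∣ N :=
    (Finset.dvd_prod_of_mem (fun i => (q v i).den) (Finset.mem_univ i)).trans
      (Finset.dvd_prod_of_mem (fun v => ∏ i, (q v i).den) (hfin.mem_toFinset.2 hv))
  refine ⟨(q v i).num * c, ?_⟩
  have h := Rat.mul_den_eq_num (q v i)
  have h' : (q v i : ℝ) * (q v i).den = (q v i).num := by exact_mod_cast h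
  change (N : ℝ) * v i = _
  rw [hq v hv i, hc]
  push_cast
  rw [← h']
  ring

theorem denominator_spec {d : ℕ} {P : Set (Fin d → ℝ)} (hP : IsRationalPolytope P) :
    0 < denominator P ∧
      ∀ v ∈ P.extremePoints ℝ, (denominator P : ℝ) • v ∈ integerLattice d := by
  obtain ⟨h0, -, h⟩ := Nat.sInf_mem
    (s := {n : ℕ | 0 < n ∧ IsIntegralPolytope ((n : ℝ) • P)}) hP.exists_isIntegralPolytope_smul
  refine ⟨h0, fun v hv => h _ ?_⟩
  rw [extremePoints_smul (by exact_mod_cast h0.ne')]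
  exact Set.smul_mem_smul_set hv

/-! ### Area asymptotics and boundary counts -/

theorem integerLattice_eq_span (d : ℕ) :
    integerLattice d = (Submodule.span ℤ (Set.range (Pi.basisFun ℝ (Fin d))) : Set (Fin d → ℝ)) := by
  ext x
  rw [SetLike.mem_coe, (Pi.basisFun ℝ (Fin d)).mem_span_iff_repr_mem ℤ]
  simp only [integerLattice, Set.mem_ofPred_eq, Pi.basisFun_repr, Set.mem_range, algebraMap_int_eq,
    eq_intCast]
  exact forall_congr' fun i => exists_congr fun z => eq_comm

/-- Shrinking by `1 / n` turns the count into one of points of `(1/n)ℤ²` in `P`; the frontier of a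
convex set is null. -/
theorem tendsto_ehrhartCount_div_sq {P : Set (Fin 2 → ℝ)} (hP : IsCompact P) (hc : Convex ℝ P) :
    Filter.Tendsto (fun n : ℕ => (ehrhartCount P n : ℝ) / (n : ℝ) ^ 2) Filter.atTop
      (nhds (MeasureTheory.volume.real P)) := by
  have h := tendsto_card_div_pow_atTop_volume P hP.isBounded hP.measurableSet
    (hc.addHaar_frontier MeasureTheory.volume)
  refine h.congr' ?_
  filter_upwards [Filter.eventually_gt_atTop 0] with n hn
  have hn' : (n : ℝ) ≠ 0 := by positivity
  rw [Fintype.card_fin, ehrhartCount, ← Set.ncard_image_of_injective _ (smul_right_injective (Fin 2 → ℝ) (inv_ne_zero hn')),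
    Set.image_smul, Set.smul_set_inter₀ (inv_ne_zero hn'), inv_smul_smul₀ hn', integerLattice_eq_span]
  rfl

theorem boundaryCount_eq_sub {P : Set (Fin 2 → ℝ)} (hP : IsCompact P) {n : ℕ} (hn : 1 ≤ n) :
    (boundaryCount P n : ℝ) = ehrhartCount P n - ehrhartCount (interior P) n := by
  have hn' : (n : ℝ) ≠ 0 := by positivity
  have hfin := finite_inter_integerLattice (hP.isBounded.smul₀ (n : ℝ))
  have hsub : (n : ℝ) • interior P ∩ integerLattice 2 ⊆ (n : ℝ) • P ∩ integerLattice 2 :=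
    Set.inter_subset_inter_left _ (Set.smul_set_mono interior_subset)
  rw [eq_sub_iff_add_eq, boundaryCount, (hP.smul (n : ℝ)).isClosed.frontier_eq,
    interior_smul₀ hn', ehrhartCount, ehrhartCount,
    ← Set.ncard_sdiff_add_ncard_of_subset hsub hfin]
  push_cast
  congr 3
  ext x
  simp only [Set.mem_inter_iff, Set.mem_sdiff]
  tauto

/-! ### The equivalences -/

theorem IsQuasiQuadratic.leadingCoeff_eq {D : ℕ} (hD : 0 < D) {Q : ℤ → ℝ}
    (hQ : IsQuasiQuadratic D Q) {A : ℝ}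
    (hA : Filter.Tendsto (fun n : ℕ => Q n / (n : ℝ) ^ 2) Filter.atTop (nhds A)) (r : ℕ) :
    ∃ b c : ℝ, ∀ m : ℤ, Q (r + D * m) = A * (r + D * m) ^ 2 + b * m + c := by
  obtain ⟨a, b, c, h⟩ := hQ r
  have hsub : Filter.Tendsto (fun m : ℕ => r + D * m) Filter.atTop Filter.atTop :=
    Filter.tendsto_atTop_mono (fun m => le_add_left (Nat.le_mul_of_pos_left m hD))
      Filter.tendsto_id
  have h0 := fun x : ℝ => tendsto_const_div_atTop_nhds_zero_nat x
  have h1 : Filter.Tendsto (fun m : ℕ => ((r : ℝ) / m + D) ^ 2) Filter.atTop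
      (nhds ((0 + (D : ℝ)) ^ 2)) := ((h0 r).add_const _).pow 2
  have h2 : Filter.Tendsto (fun m : ℕ => a + b / m + c / m * (1 / m : ℝ)) Filter.atTop
      (nhds (a + 0 + 0 * 0)) := ((h0 b).const_add a).add ((h0 c).mul (h0 1))
  have h3 := (hA.comp hsub).mul h1
  have h4 : A * (0 + (D : ℝ)) ^ 2 = a + 0 + 0 * 0 := by
    refine tendsto_nhds_unique h3 (h2.congr' ?_)
    filter_upwards [Filter.eventually_gt_atTop 0] with m hm
    have hm' : (0 : ℝ) < m := by exact_mod_cast hm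
    have hDR : (0 : ℝ) < D := by exact_mod_cast hD
    have h5 := h m
    simp only [Function.comp]
    push_cast at h5 ⊢
    rw [h5]
    field_simp
  obtain rfl : a = A * D ^ 2 := by linarith
  exact ⟨b - 2 * A * r * D, c - A * r ^ 2, fun m => by rw [h]; ring⟩

/-- The equivalences for a reciprocal pair `i`, `o` of counting functions with `i 0 = 1`. -/
theorem Reciprocal.tfae_polynomial {D : ℕ} (hD : 0 < D) {i o bd : ℕ → ℝ} (h : Reciprocal D i o)
    {A : ℝ} (hA : Filter.Tendsto (fun n : ℕ => i n / (n : ℝ) ^ 2) Filter.atTop (nhds A))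
    (hi0 : i 0 = 1) (hb : ∀ n, 1 ≤ n → bd n = i n - o n) :
    List.TFAE [
      ∃ p : Polynomial ℝ, ∀ n : ℕ, i n = p.eval (n : ℝ),
      ∀ n : ℕ, i n = A * (n : ℝ) ^ 2 + (1 / 2 : ℝ) * bd 1 * (n : ℝ) + 1,
      ∀ n : ℕ, 1 ≤ n → i n = A * (n : ℝ) ^ 2 + (1 / 2 : ℝ) * bd n + 1 ∧ bd n = n * bd 1,
      ∀ n : ℕ, 1 ≤ n → n ≤ D →
        i n = A * (n : ℝ) ^ 2 + (1 / 2 : ℝ) * bd n + 1 ∧ bd n = n * bd 1] := by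
  obtain ⟨Q, hQ, hi, ho⟩ := h
  have hDR : (0 : ℝ) < D := by exact_mod_cast hD
  have hlead := hQ.leadingCoeff_eq hD (A := A) (by simpa only [hi] using hA)
  have hQ0 : Q 0 = 1 := by rw [← hi0, hi]; rfl
  -- Two values determine `Q` on a residue class.
  have hext : ∀ β : ℝ, (∀ r : ℕ, 1 ≤ r → r ≤ D → Q r = A * (r : ℝ) ^ 2 + β * r + 1 ∧
      ∃ m : ℤ, m ≠ 0 ∧ Q (r + D * m) = A * (r + D * m) ^ 2 + β * (r + D * m) + 1) →
      ∀ n : ℤ, Q n = A * (n : ℝ) ^ 2 + β * n + 1 := by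
    intro β hβ n
    -- Representatives run over `1, …, D` rather than `0, …, D - 1`, to match the range of the
    -- finite condition.
    obtain ⟨r, m, hr1, hrD, rfl⟩ : ∃ (r : ℕ) (m : ℤ), 1 ≤ r ∧ r ≤ D ∧ n = r + D * m := by
      have hDZ : (0 : ℤ) < D := by exact_mod_cast hD
      have h1 := Int.emod_nonneg (n - 1) hDZ.ne'
      have h2 := Int.emod_lt_of_pos (n - 1) hDZ
      have h3 := Int.emod_add_mul_ediv (n - 1) D
      refine ⟨((n - 1) % D + 1).toNat, (n - 1) / D, by omega, by omega, ?_⟩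
      rw [Int.toNat_of_nonneg (by omega)]
      linarith
    obtain ⟨h1, m', hm', h2⟩ := hβ r hr1 hrD
    obtain ⟨b, c, hbc⟩ := hlead r
    have h3 := hbc 0
    simp only [mul_zero, add_zero, Int.cast_zero] at h3
    have hc : c = β * r + 1 := by linarith
    have h4 := hbc m'
    have hb' : b = β * D := by
      have hm'' : (m' : ℝ) ≠ 0 := by exact_mod_cast hm'
      apply mul_right_cancel₀ hm''
      linarith
    rw [hbc, hc, hb']
    push_cast
    ring
  have hboundary : ∀ β : ℝ, (∀ n : ℤ, Q n = A * (n : ℝ) ^ 2 + β * n + 1) →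
      ∀ n, 1 ≤ n → bd n = 2 * β * n := by
    intro β hβ n hn
    rw [hb n hn, hi, ho n hn, hβ, hβ]
    push_cast
    ring
  have hnat : ∀ β : ℝ, (∀ n : ℕ, i n = A * (n : ℝ) ^ 2 + β * n + 1) →
      ∀ n : ℤ, Q n = A * (n : ℝ) ^ 2 + β * n + 1 := by
    intro β hβ
    refine hext β fun r _ _ => ⟨by rw [← hi, hβ], 1, one_ne_zero, ?_⟩
    have := hβ (r + D)
    rw [hi] at this
    push_cast at this
    simpa using this
  tfae_have 1 → 2 := by
    rintro ⟨p, hp⟩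
    obtain ⟨b, c, hbc⟩ := hlead 0
    have hc : c = 1 := by
      have := hbc 0
      simp only [Nat.cast_zero, mul_zero, add_zero, Int.cast_zero, hQ0] at this
      linarith
    subst hc
    -- Only the class of `0` is needed: a polynomial is determined by its values at the multiples of
    -- `D`.
    have hpoly : p = Polynomial.C A * Polynomial.X ^ 2 + Polynomial.C (b / D) * Polynomial.X + 1 := by
      refine Polynomial.eq_of_infinite_eval_eq _ _ ((Set.infinite_range_of_injective
        (f := fun m : ℕ => (D : ℝ) * m) fun m m' h => ?_).mono ?_)
      · exact_mod_cast mul_left_cancel₀ hDR.ne' h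
      · rintro _ ⟨m, rfl⟩
        have h1 := hp (D * m)
        have h2 := hbc m
        rw [hi] at h1
        push_cast at h1 h2
        rw [zero_add] at h2
        rw [Set.mem_ofPred_eq, ← h1, h2]
        simp only [Polynomial.eval_add, Polynomial.eval_mul, Polynomial.eval_C,
          Polynomial.eval_pow, Polynomial.eval_X, Polynomial.eval_one]
        field_simp
        ring
    have hval : ∀ n : ℕ, i n = A * (n : ℝ) ^ 2 + b / D * n + 1 := fun n => by
      rw [hp, hpoly]
      simp
    have h1 := hboundary _ (hnat _ hval) 1 le_rfl
    intro n
    rw [hval, h1]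
    push_cast
    ring
  tfae_have 2 → 3 := by
    intro h n hn
    have h1 := hboundary _ (hnat _ h) n hn
    rw [h1, h]
    constructor <;> ring
  tfae_have 3 → 4 := fun h n hn _ => h n hn
  tfae_have 4 → 1 := by
    intro h
    have h1 : ∀ r : ℕ, 1 ≤ r → r ≤ D → Q r = A * (r : ℝ) ^ 2 + bd 1 / 2 * r + 1 := by
      intro r hr1 hrD
      obtain ⟨h2, h3⟩ := h r hr1 hrD
      rw [← hi, h2, h3]
      ring
    -- The second value on the class is at `r - D ≤ 0`, where `Q` is `1` or an interior count.
    have h2 := hext (bd 1 / 2) fun r hr1 hrD => ⟨h1 r hr1 hrD, -1, by norm_num, ?_⟩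
    · refine ⟨Polynomial.C A * Polynomial.X ^ 2 + Polynomial.C (bd 1 / 2) * Polynomial.X + 1,
        fun n => ?_⟩
      rw [hi, h2]
      simp
    · rcases hrD.eq_or_lt with rfl | hlt
      · rw [show (r : ℤ) + r * -1 = 0 by ring, hQ0]
        push_cast
        ring
      · obtain ⟨s, rfl⟩ := Nat.exists_eq_add_of_lt hlt
        obtain ⟨h3, h4⟩ := h (s + 1) (by omega) (by omega)
        have h5 := hb (s + 1) (by omega)
        have h6 := ho (s + 1) (by omega)
        rw [show (r : ℤ) + ((r + s + 1 : ℕ) : ℤ) * -1 = -((s + 1 : ℕ) : ℤ) by push_cast; ring, ← h6,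
          show o (s + 1) = i (s + 1) - bd (s + 1) by linarith, h3, h4]
        push_cast
        ring
  tfae_finish

theorem theorem3p1 (P : Set (Fin 2 → ℝ)) (hP : IsRationalPolygon P)
    (A : ℝ) (hA : A = MeasureTheory.volume.real P)
    (D : ℕ) (hD : D = denominator P) :
    List.TFAE [
      ∃ p : Polynomial ℝ, ∀ n : ℕ, (ehrhartCount P n : ℝ) = p.eval (n : ℝ),
      ∀ n : ℕ, (ehrhartCount P n : ℝ) =
        A * (n : ℝ) ^ 2 + (1 / 2 : ℝ) * (boundaryCount P 1 : ℝ) * (n : ℝ) + 1,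
      ∀ n : ℕ, 1 ≤ n →
        (ehrhartCount P n : ℝ) =
            A * (n : ℝ) ^ 2 + (1 / 2 : ℝ) * (boundaryCount P n : ℝ) + 1 ∧
          boundaryCount P n = n * boundaryCount P 1,
      ∀ n : ℕ, 1 ≤ n → n ≤ D →
        (ehrhartCount P n : ℝ) =
            A * (n : ℝ) ^ 2 + (1 / 2 : ℝ) * (boundaryCount P n : ℝ) + 1 ∧
          boundaryCount P n = n * boundaryCount P 1] := by
  subst hA hD
  obtain ⟨⟨hpoly, hrat⟩, hint⟩ := hP
  obtain ⟨hD, hV⟩ := denominator_spec ⟨hpoly, hrat⟩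
  have hhull := hpoly.convexHull_extremePoints
  have hrec := reciprocal_ehrhartCount_convexHull hD _ _ hpoly.finite_extremePoints rfl
    (by rw [hhull]) hV (by rwa [hhull])
  rw [hhull] at hrec
  have := hrec.tfae_polynomial hD (bd := fun n => boundaryCount P n)
    (tendsto_ehrhartCount_div_sq hpoly.isCompact hpoly.convex)
    (by exact_mod_cast ehrhartCount_zero (hint.mono interior_subset))
    (fun n hn => boundaryCount_eq_sub hpoly.isCompact hn)
  exact_mod_cast this
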